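/- Let $\Sigma$ be a finite nonempty alphabet (for instance $\Sigma=\{0,1\}$) and let $\mathcal F$ be a class of next-token generators $f:\Sigma^\star\to\Sigma$. For $f\in\mathcal F$ put $\bar f(x)=x\circ f(x)$ (append the symbol $f(x)$ to $x$); let $f^{\mathsf{CoT},T}(x)\in\Sigma^T$ be the length-$T$ suffix of $\bar f^{\,T}(x)$ and, for $T\ge 1$, let $f^{\mathsf{e2e},T}(x)\in\Sigma$ be its last symbol. Put $\mathcal F^{\mathsf{CoT},T}=\{f^{\mathsf{CoT},T}:f\in\mathcal F\}$. **Stable compression.** Let $\mathcal H\subseteq\mathcal Y^{\mathcal X}$. A sample is a finite sequence of examples $(x,y)\in\mathcal X\times\mathcal Y$; it is realizable if some $h\in\mathcal H$ satisfies $h(x)=y$ for all its examples. "$\mathcal H$ has a stable sample compression scheme of size $k$" is understood in either of two forms (subsamples are subsequences). * (Pair of maps.) There are maps $\kappa$ (samples to samples) and $\rho$ (samples to $\mathcal Y^{\mathcal X}$) such that, for every realizable sample $S$: $\kappa(S)$ is a subsample of $S$ of size at most $k$; $\rho(\kappa(S))$ is consistent with $S$; and $\kappa(S')=\kappa(S)$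 whenever $S'$ is obtained from $S$ by deleting one example and still has $\kappa(S)$ as a subsample. * (Learning rule.) There is a map $A$ from samples to $\mathcal Y^{\mathcal X}$ such that every realizable sample $S$ has a subsample $K$ of size at most $k$ with $A(S')=A(S)$ for all $K\subseteq S'\subseteq S$, and $A(S)$ is consistent with $S$. **Learning with chain-of-thought supervision.** Let $T\ge1$. A learning rule maps samples in $(\Sigma^\star\times\Sigma^T)^\star$ to predictors $\Sigma^\star\to\Sigma$. It succeeds with $m$ examples at $(\epsilon,\delta)$ if for every probability distribution $\mathcal D$ on $\Sigma^\star$ and every $f_\star\in\mathcal F$, when $x_1,\dots,x_m\sim\mathcal D$ are i.i.d. and $h$ is its output on $((x_i,f_\star^{\mathsf{CoT},T}(x_i)))_{i=1}^m$, the probability that $\Pr_{x\sim\mathcal D}[h(x)\ne f_\star^{\mathsf{e2e},T}(x)]>\epsilon$ is at most $\delta$. The sample complexity $m_{\mathcal F}^{\mathsf{CoT},T}(\epsilon,\delta)$ is the smallest $m$ for which some learning rule succeeds with $m$ examples at $(\epsilon,\delta)$. $\mathcal F$ with generation length $T$ is learnable with chain-of-thought supervision with sample complexity $m(\epsilon,\delta)$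 if a single learning rule succeeds with $m(\epsilon,\delta)$ examples at $(\epsilon,\delta)$, for all $\epsilon,\delta>0$. **Proposition.** There is an absolute constant $C>0$ such that, for all $\Sigma$, $\mathcal F$ as above and all integers $k\ge 0$: 1. If $\mathcal F$ has a stable sample compression scheme of size $k$, then for every $T\ge 0$ the class $\mathcal F^{\mathsf{CoT},T}$ has a stable sample compression scheme of size $k$. This holds for each of the two forms (the same form in the hypothesis and in the conclusion). 2. If $\mathcal F$ has a stable sample compression scheme of size $k$, in either form, then there is a function $m:\mathbb R\times\mathbb R\to\mathbb N$, not depending on $T$, with $$m(\epsilon,\delta)\le C\,\frac{k+\log(1/\delta)}{\epsilon}\qquad\text{for all }\epsilon>0,\ 0<\delta\le 1,$$ such that for every $T\ge1$, $\mathcal F$ with generation length $T$ is learnable with chain-of-thought supervision with sample complexity $m$, and in particular $m_{\mathcal F}^{\mathsf{CoT},T}(\epsilon,\delta)\le m(\epsilon,\delta)$ for all $\epsilon,\delta>0$. -/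

import Mathlib

open MeasureTheory

/-! ### Samples and stable sample compression, for an arbitrary domain `X` and label set `Y` -/

/-- A finite sequence of labelled examples is realizable by the class `H`. -/
def Realizable {X Y : Type*} (H : Set (X → Y)) (S : List (X × Y)) : Prop :=
  ∃ h ∈ H, ∀ p ∈ S, h p.1 = p.2

/-- The pair `(κ, ρ)` of a compression map and a reconstruction map is a stable sample compression
scheme (without side information) of size `k` for `H`. Only the values of `κ` on realizable samples,
and those of `ρ` on compressed samples, matter. The last clause is stability under the deletion of
one example outside the compressed subsample. -/
structure IsStableCompressionScheme {X Y : Type*} (H : Set (X → Y)) (k : ℕ)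
    (κ : List (X × Y) → List (X × Y)) (ρ : List (X × Y) → X → Y) : Prop where
  sublist : ∀ S, Realizable H S → (κ S).Sublist S
  size_le : ∀ S, Realizable H S → (κ S).length ≤ k
  consistent : ∀ S, Realizable H S → ∀ p ∈ S, ρ (κ S) p.1 = p.2
  stable : ∀ S, Realizable H S → ∀ i < S.length,
    (κ S).Sublist (S.eraseIdx i) → κ (S.eraseIdx i) = κ S

/-- `H` has a stable sample compression scheme of size `k`, in the form of a pair `(κ, ρ)`. -/
def HasStableCompressionScheme {X Y : Type*} (H : Set (X → Y)) (k : ℕ) : Prop :=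
  ∃ κ ρ, IsStableCompressionScheme H k κ ρ

/-- The learning rule `A` is a stable sample compression scheme of size `k` for `H`: on every
realizable sample `S`, its output is consistent with `S` and is already determined, stably, by some
subsample `K` of at most `k` examples. -/
def IsStableCompressionRule {X Y : Type*} (H : Set (X → Y)) (k : ℕ)
    (A : List (X × Y) → X → Y) : Prop :=
  ∀ S, Realizable H S → ∃ K : List (X × Y), K.Sublist S ∧ K.length ≤ k ∧
    (∀ S' : List (X × Y), K.Sublist S' → S'.Sublist S → A S' = A S) ∧
    ∀ p ∈ S, A S p.1 = p.2

/-- `H` has a stable sample compression scheme of size `k`, in the form of a learning rule. -/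
def HasStableCompressionRule {X Y : Type*} (H : Set (X → Y)) (k : ℕ) : Prop :=
  ∃ A, IsStableCompressionRule H k A

/-! ### Autoregressive generation over a token set `Tok` -/

/-- One generation step: append the next token produced by `f`. -/
def genStep {Tok : Type*} (f : List Tok → Tok) (x : List Tok) : List Tok :=
  x ++ [f x]

theorem length_genStep_iterate {Tok : Type*} (f : List Tok → Tok) (T : ℕ) (x : List Tok) :
    ((genStep f)^[T] x).length = x.length + T := by
  induction T with
  | zero => simp
  | succ T ih =>
    rw [Function.iterate_succ_apply']
    simp only [genStep, List.length_append, List.length_singleton, ih]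
    omega

/-- The `T`-step chain of thought of `f` on `x`: the suffix of length `T` of the string obtained
from `x` by `T` generation steps. -/
def cot {Tok : Type*} (f : List Tok → Tok) (T : ℕ) (x : List Tok) : Fin T → Tok :=
  fun t => ((genStep f)^[T] x)[x.length + t.val]'(by
    rw [length_genStep_iterate]; have := t.isLt; omega)

/-- The end-to-end output: the last token of the chain of thought, for `T ≥ 1`. -/
def e2e {Tok : Type*} (f : List Tok → Tok) {T : ℕ} (hT : 1 ≤ T) (x : List Tok) : Tok :=
  cot f T x ⟨T - 1, by omega⟩

/-- The class of `T`-step chains of thought of the generators in `F`. -/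
def cotClass {Tok : Type*} (F : Set (List Tok → Tok)) (T : ℕ) :
    Set (List Tok → Fin T → Tok) :=
  (fun f => cot f T) '' F

/-! ### Learning with chain-of-thought supervision -/

/-- Strings over a finite alphabet form a countable set, and carry the discrete σ-algebra. -/
instance stringMeasurableSpace {Tok : Type*} : MeasurableSpace (List Tok) := ⊤

/-- `m` examples suffice for the learning rule `Lrn` to learn `F` with generation length `T` under
chain-of-thought supervision, with accuracy `ε` and confidence `1 - δ`: for every distribution `D`
of the prompts and every target `f ∈ F`, given `m` independent prompts drawn from `D` with the full
chains of thought of `f`, the end-to-end error of the output exceeds `ε` with probability at most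
`δ`. -/
def CoTSuffices {Tok : Type*} (F : Set (List Tok → Tok)) {T : ℕ} (hT : 1 ≤ T)
    (Lrn : List (List Tok × (Fin T → Tok)) → List Tok → Tok) (m : ℕ) (ε δ : ℝ) : Prop :=
  ∀ (D : Measure (List Tok)) [IsProbabilityMeasure D], ∀ f ∈ F,
    Measure.pi (fun _ : Fin m => D)
      {xs | ENNReal.ofReal ε <
        D {x | Lrn (List.ofFn fun i => (xs i, cot f T (xs i))) x ≠ e2e f hT x}}
      ≤ ENNReal.ofReal δ

/-- `F` with generation length `T` is learnable with chain-of-thought supervision with sample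
complexity `m = m(ε, δ)`, by one learning rule for all `ε` and `δ`. -/
def CoTLearnableWith {Tok : Type*} (F : Set (List Tok → Tok)) {T : ℕ} (hT : 1 ≤ T)
    (m : ℝ → ℝ → ℕ) : Prop :=
  ∃ Lrn, ∀ ε δ : ℝ, 0 < ε → 0 < δ → CoTSuffices F hT Lrn (m ε δ) ε δ

/-- The chain-of-thought supervision sample complexity: the smallest number of examples that
suffices for some learning rule (`⊤` if there is none). -/
noncomputable def cotSampleComplexity {Tok : Type*} (F : Set (List Tok → Tok)) {T : ℕ}
    (hT : 1 ≤ T) (ε δ : ℝ) : ℕ∞ :=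
  ⨅ (m : ℕ) (_ : ∃ Lrn, CoTSuffices F hT Lrn m ε δ), (m : ℕ∞)

/-! ### Stable compression schemes -/

/-! A chain-of-thought example unrolls into `T` next-token examples (`nextTokenExamples`), and a
generator correct on all of these reproduces the whole chain (`cot_eq_of_forall`). So apply the
given scheme to the unrolled sample. Each compressed next-token example comes from one chain, so at
most `k` chains cover them all. Those chains unroll to further examples, but stability makes the
extra ones harmless. Hence the size stays `k` for every `T`.

For the sample bound, cut the sample into `2k` blocks. By stability the output is determined by some
`k` whole blocks, and it is consistent with the other `k`, which are independent of them. The union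
bound thus runs over at most `4 ^ k` choices of blocks instead of all choices of `k` examples, so no
logarithmic factor in `1/ε` appears (`IsStableCompressionRule.measure_pi_error_le`). -/

theorem Realizable.of_sublist {X Y : Type*} {H : Set (X → Y)} {S S' : List (X × Y)}
    (hS : Realizable H S) (h : S'.Sublist S) : Realizable H S' := by
  obtain ⟨f, hf, hfS⟩ := hS
  exact ⟨f, hf, fun p hp => hfS p (h.subset hp)⟩

/-- A proper sublist survives the deletion of some entry. -/
theorem List.Sublist.exists_eraseIdx {α : Type*} {l₁ l₂ : List α} (h : l₁.Sublist l₂)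
    (hlt : l₁.length < l₂.length) : ∃ i < l₂.length, l₁.Sublist (l₂.eraseIdx i) := by
  induction h with
  | slnil => simp at hlt
  | cons a h ih => exact ⟨0, by simp, by simpa using h⟩
  | cons_cons a h ih =>
    obtain ⟨i, hi, hs⟩ := ih (by simpa using hlt)
    exact ⟨i + 1, by simpa using hi, by simpa using hs⟩

/-- Stability under one deletion implies stability under any number of deletions. -/
theorem IsStableCompressionScheme.eq_of_sublist {X Y : Type*} {H : Set (X → Y)} {k : ℕ}
    {κ : List (X × Y) → List (X × Y)} {ρ : List (X × Y) → X → Y}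
    (hκ : IsStableCompressionScheme H k κ ρ) {S' : List (X × Y)} :
    ∀ {S : List (X × Y)}, Realizable H S → (κ S).Sublist S' → S'.Sublist S → κ S' = κ S := by
  suffices h : ∀ n, ∀ S : List (X × Y), S.length = n → Realizable H S → (κ S).Sublist S' →
      S'.Sublist S → κ S' = κ S from fun {S} => h _ S rfl
  intro n
  induction n with
  | zero =>
    intro S hn hS h₁ h₂
    rw [h₂.eq_of_length_le (by omega)]
  | succ n ih =>
    intro S hn hS h₁ h₂
    rcases h₂.length_le.eq_or_lt with heq | hlt
    · rw [h₂.eq_of_length heq]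
    · obtain ⟨i, hi, hs⟩ := h₂.exists_eraseIdx hlt
      have hstep := hκ.stable S hS i hi (h₁.trans hs)
      rw [← hstep] at h₁ ⊢
      exact ih _ (by rw [List.length_eraseIdx_of_lt hi]; omega)
        (hS.of_sublist (List.eraseIdx_sublist S i)) h₁ hs

theorem HasStableCompressionScheme.hasStableCompressionRule {X Y : Type*} {H : Set (X → Y)}
    {k : ℕ} (h : HasStableCompressionScheme H k) : HasStableCompressionRule H k := by
  obtain ⟨κ, ρ, hκ⟩ := h
  refine ⟨fun S => ρ (κ S), fun S hS => ⟨κ S, hκ.sublist S hS, hκ.size_le S hS, ?_,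
    hκ.consistent S hS⟩⟩
  intro S' h₁ h₂
  simp only [hκ.eq_of_sublist hS h₁ h₂]

/-- A sublist of `S.flatMap e` comes from at most as many members of `S`. -/
theorem List.Sublist.exists_of_flatMap {α β : Type*} {e : α → List β} {S : List α} :
    ∀ {L : List β}, L.Sublist (S.flatMap e) →
      ∃ K : List α, K.Sublist S ∧ K.length ≤ L.length ∧ L.Sublist (K.flatMap e) := by
  induction S with
  | nil => intro L hL; exact ⟨[], by simp, by simp, by simpa using hL⟩
  | cons a S ih =>
    intro L hL
    rw [List.flatMap_cons, List.sublist_append_iff] at hL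
    obtain ⟨L₁, L₂, rfl, h₁, h₂⟩ := hL
    obtain ⟨K, hK, hlen, hs⟩ := ih h₂
    -- A member contributing nothing to `L` is dropped; every member kept accounts for at least one
    -- entry of `L`.
    by_cases hn : L₁ = []
    · subst hn
      exact ⟨K, hK.cons a, by simpa using hlen, by simpa using hs⟩
    · have := List.length_pos_iff.mpr hn
      refine ⟨a :: K, hK.cons_cons a, by simp; omega, ?_⟩
      rw [List.flatMap_cons]
      exact h₁.append hs

theorem List.Sublist.flatMap_left {α β : Type*} (e : α → List β) {S' S : List α}
    (h : S'.Sublist S) : (S'.flatMap e).Sublist (S.flatMap e) := by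
  induction h with
  | slnil => simp
  | cons a h ih =>
    rw [List.flatMap_cons]
    exact ih.trans (List.sublist_append_right _ _)
  | cons_cons a h ih =>
    rw [List.flatMap_cons, List.flatMap_cons]
    exact (List.Sublist.refl _).append ih

/-- `e` replaces an example for the class `H'` by several examples for the class `H`, and `Φ` turns
predictors for the latter into predictors for the former, preserving consistency. -/
structure IsSampleReduction {X Y X' Y' : Type*} (H : Set (X → Y)) (H' : Set (X' → Y'))
    (e : X' × Y' → List (X × Y)) (Φ : (X → Y) → X' → Y') : Prop where
  realizable : ∀ S, Realizable H' S → Realizable H (S.flatMap e)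
  consistent : ∀ (h : X → Y) (p : X' × Y'), (∀ q ∈ e p, h q.1 = q.2) → Φ h p.1 = p.2

/-- The expansion of any sample between `K` and `S` lies between the compressed subsample `L` and
the full expansion, where stability fixes the output of `A`. -/
theorem IsSampleReduction.hasStableCompressionRule {X Y X' Y' : Type*} {H : Set (X → Y)}
    {H' : Set (X' → Y')} {e : X' × Y' → List (X × Y)} {Φ : (X → Y) → X' → Y'}
    (he : IsSampleReduction H H' e Φ) {k : ℕ} (h : HasStableCompressionRule H k) :
    HasStableCompressionRule H' k := by
  obtain ⟨A, hA⟩ := h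
  refine ⟨fun S => Φ (A (S.flatMap e)), fun S hS => ?_⟩
  obtain ⟨L, hL, hLk, hst, hcons⟩ := hA _ (he.realizable S hS)
  obtain ⟨K, hK, hKL, hLK⟩ := hL.exists_of_flatMap
  refine ⟨K, hK, hKL.trans hLk, fun S' h₁ h₂ => ?_, fun p hp => ?_⟩
  · simp only [hst _ (hLK.trans (h₁.flatMap_left e)) (h₂.flatMap_left e)]
  · exact he.consistent _ p fun q hq => hcons q (List.mem_flatMap.mpr ⟨p, hp, hq⟩)

/-- The compressed samples for the lifted scheme are the least ones, for a fixed well-order, among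
those whose expansion contains the compressed expanded sample. -/
theorem IsSampleReduction.hasStableCompressionScheme {X Y X' Y' : Type*} {H : Set (X → Y)}
    {H' : Set (X' → Y')} {e : X' × Y' → List (X × Y)} {Φ : (X → Y) → X' → Y'}
    (he : IsSampleReduction H H' e Φ) {k : ℕ} (h : HasStableCompressionScheme H k) :
    HasStableCompressionScheme H' k := by
  classical
  obtain ⟨κ, ρ, hκ⟩ := h
  let r : List (X' × Y') → List (X' × Y') → Prop := WellOrderingRel
  have wf : WellFounded r := IsWellFounded.wf
  let C : List (X' × Y') → Set (List (X' × Y')) := fun S =>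
    {K | K.Sublist S ∧ K.length ≤ k ∧ (κ (S.flatMap e)).Sublist (K.flatMap e)}
  let κ' : List (X' × Y') → List (X' × Y') := fun S =>
    if hne : (C S).Nonempty then wf.min (C S) hne else []
  have hne : ∀ S, Realizable H' S → (C S).Nonempty := fun S hS => by
    have hR := he.realizable S hS
    obtain ⟨K, hK, hKL, hLK⟩ := (hκ.sublist _ hR).exists_of_flatMap
    exact ⟨K, hK, hKL.trans (hκ.size_le _ hR), hLK⟩
  have hκ' : ∀ S (hS : Realizable H' S), κ' S = wf.min (C S) (hne S hS) := fun S hS =>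
    dif_pos (hne S hS)
  have hmem : ∀ S, Realizable H' S → κ' S ∈ C S := fun S hS => by
    rw [hκ' S hS]; exact wf.min_mem _ _
  have heq : ∀ S S', Realizable H' S → (κ' S).Sublist S' → S'.Sublist S →
      κ (S'.flatMap e) = κ (S.flatMap e) := fun S S' hS h₁ h₂ =>
    hκ.eq_of_sublist (he.realizable S hS) ((hmem S hS).2.2.trans (h₁.flatMap_left e))
      (h₂.flatMap_left e)
  -- Reconstruction recomputes `κ` on the expansion of `K`; by stability this recovers the
  -- compression of the full expansion.
  refine ⟨κ', fun K => Φ (ρ (κ (K.flatMap e))), fun S hS => (hmem S hS).1,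
    fun S hS => (hmem S hS).2.1, fun S hS p hp => ?_, fun S hS i _ hi => ?_⟩
  · refine he.consistent _ p fun q hq => ?_
    rw [heq S (κ' S) hS (List.Sublist.refl _) (hmem S hS).1]
    exact hκ.consistent _ (he.realizable S hS) q (List.mem_flatMap.mpr ⟨p, hp, hq⟩)
  · have hsub : (S.eraseIdx i).Sublist S := List.eraseIdx_sublist S i
    have hS' := hS.of_sublist hsub
    have hk := heq S _ hS hi hsub
    -- Each of the two minima is a candidate for the other sample, so neither precedes the other and
    -- trichotomy makes them equal.
    have h₁ : κ' S ∈ C (S.eraseIdx i) :=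
      ⟨hi, (hmem S hS).2.1, by rw [hk]; exact (hmem S hS).2.2⟩
    have h₂ : κ' (S.eraseIdx i) ∈ C S := by
      obtain ⟨ha, hb, hc⟩ := hmem _ hS'
      exact ⟨ha.trans hsub, hb, by rwa [hk] at hc⟩
    have n₁ : ¬ r (κ' S) (κ' (S.eraseIdx i)) := by
      rw [hκ' _ hS']; exact wf.not_lt_min _ h₁
    have n₂ : ¬ r (κ' (S.eraseIdx i)) (κ' S) := by
      rw [hκ' S hS]; exact wf.not_lt_min _ h₂
    rcases trichotomous_of r (κ' S) (κ' (S.eraseIdx i)) with h | h | h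
    exacts [absurd h n₁, h.symm, absurd h n₂]

/-! ### Chains of thought -/

theorem genStep_iterate_eq {Tok : Type*} (f : List Tok → Tok) (T : ℕ) (x : List Tok) :
    (genStep f)^[T] x = x ++ List.ofFn (cot f T x) := by
  have hpre : x <+: (genStep f)^[T] x := by
    induction T with
    | zero => simp
    | succ T ih =>
      rw [Function.iterate_succ_apply']
      exact ih.trans (List.prefix_append _ _)
  obtain ⟨y, hy⟩ := hpre
  have hlen : y.length = T := by
    have := length_genStep_iterate f T x
    rw [← hy, List.length_append] at this
    omega
  rw [← hy]
  congr 1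
  apply List.ext_getElem
  · simp [hlen]
  · intro i h₁ h₂
    simp [cot, ← hy]

/-- Each token of a chain of thought is the next token after the prompt and the earlier tokens. -/
theorem cot_apply {Tok : Type*} (f : List Tok → Tok) (T : ℕ) (x : List Tok) (t : Fin T) :
    cot f T x t = f (x ++ (List.ofFn (cot f T x)).take t) := by
  induction T with
  | zero => exact t.elim0
  | succ T ih =>
    have h : List.ofFn (cot f (T + 1) x)
        = List.ofFn (cot f T x) ++ [f (x ++ List.ofFn (cot f T x))] := by
      have := genStep_iterate_eq f (T + 1) x
      rw [Function.iterate_succ_apply', genStep_iterate_eq f T x, genStep, List.append_assoc] at this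
      exact (List.append_cancel_left this).symm
    have hget : cot f (T + 1) x t = (List.ofFn (cot f (T + 1) x))[t.val]'(by simp; omega) :=
      (List.getElem_ofFn _).symm
    rw [hget]
    simp only [h]
    rcases Nat.lt_succ_iff_lt_or_eq.mp t.isLt with ht | ht
    · rw [List.getElem_append_left (by simpa using ht), List.getElem_ofFn,
        List.take_append_of_le_length (by simpa using ht.le)]
      exact ih ⟨t, ht⟩
    · rw [List.getElem_append_right (by simp [ht]), List.take_append_of_le_length (by simp [ht])]
      simp [ht, List.take_of_length_le]

/-- A function that predicts every token of `y` from the prompt and the earlier tokens has `y` as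
its chain of thought. -/
theorem cot_eq_of_forall {Tok : Type*} {f : List Tok → Tok} {T : ℕ} {x : List Tok}
    {y : Fin T → Tok} (h : ∀ t : Fin T, f (x ++ (List.ofFn y).take t) = y t) :
    cot f T x = y := by
  suffices H : ∀ n, ∀ hn : n < T, cot f T x ⟨n, hn⟩ = y ⟨n, hn⟩ from funext fun t => H t t.isLt
  intro n
  induction n using Nat.strong_induction_on with
  | _ n ih =>
    intro hn
    rw [cot_apply, ← h ⟨n, hn⟩]
    congr 2
    apply List.ext_getElem
    · simp
    · intro i h₁ h₂
      have hi : i < n := by simp at h₁; omega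
      simpa using ih i hi (hi.trans hn)

/-- The next-token examples contained in one chain-of-thought example. -/
def nextTokenExamples {Tok : Type*} {T : ℕ} (p : List Tok × (Fin T → Tok)) :
    List (List Tok × Tok) :=
  List.ofFn fun t : Fin T => (p.1 ++ (List.ofFn p.2).take t, p.2 t)

theorem isSampleReduction_cotClass {Tok : Type*} (F : Set (List Tok → Tok)) (T : ℕ) :
    IsSampleReduction F (cotClass F T) nextTokenExamples (fun f => cot f T) where
  realizable := by
    rintro S ⟨_, ⟨f, hf, rfl⟩, hS⟩
    refine ⟨f, hf, fun q hq => ?_⟩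
    obtain ⟨p, hp, hq⟩ := List.mem_flatMap.mp hq
    obtain ⟨t, rfl⟩ := (List.mem_ofFn' _ _).mp hq
    have := hS p hp
    simp only at this ⊢
    rw [← this]
    exact (cot_apply f T p.1 t).symm
  consistent := fun f p hp =>
    cot_eq_of_forall fun t => hp _ ((List.mem_ofFn' _ _).mpr ⟨t, rfl⟩)

/-! ### Generalization of stable compression rules -/

/-- A predictor chosen from the coordinates satisfying `p` is unlikely to have large error and yet
be consistent on all other coordinates. -/
theorem measure_pi_consistent_le {X Y ι : Type*} [MeasurableSpace X] [DiscreteMeasurableSpace X]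
    [Countable X] [Fintype ι] (D : Measure X) [IsProbabilityMeasure D] (h : X → Y) (p : ι → Prop)
    [DecidablePred p] (B : ({i // p i} → X) → X → Y) (ε : ℝ) :
    Measure.pi (fun _ : ι => D)
      {xs | ENNReal.ofReal ε < D {x | B (fun i => xs i) x ≠ h x} ∧
        ∀ i, ¬ p i → B (fun i => xs i) (xs i) = h (xs i)}
      ≤ (1 - ENNReal.ofReal ε) ^ Fintype.card {i // ¬ p i} := by
  have mp := measurePreserving_piEquivPiSubtypeProd (fun _ : ι => D) p
  let E : Set (({i // p i} → X) × ({i // ¬ p i} → X)) :=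
    {z | ENNReal.ofReal ε < D {x | B z.1 x ≠ h x} ∧ ∀ i, B z.1 (z.2 i) = h (z.2 i)}
  -- Finite products of the countable discrete space `X` are again discrete, so `B` needs no
  -- measurability.
  have hE : MeasurableSet E := MeasurableSet.of_discrete
  have hpre : {xs : ι → X | ENNReal.ofReal ε < D {x | B (fun i => xs i) x ≠ h x} ∧
        ∀ i, ¬ p i → B (fun i => xs i) (xs i) = h (xs i)}
      = MeasurableEquiv.piEquivPiSubtypeProd (fun _ => X) p ⁻¹' E := by
    ext xs
    simp [E, MeasurableEquiv.piEquivPiSubtypeProd, Equiv.piEquivPiSubtypeProd]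
  rw [hpre, mp.measure_preimage hE.nullMeasurableSet, Measure.prod_apply hE]
  calc _ ≤ ∫⁻ _, (1 - ENNReal.ofReal ε) ^ Fintype.card {i // ¬ p i}
        ∂(Measure.pi fun _ : {i // p i} => D) := by
        refine lintegral_mono fun u => ?_
        by_cases hu : ENNReal.ofReal ε < D {x | B u x ≠ h x}
        -- Once `u` is frozen, `B u` is a fixed predictor, and consistency on the remaining
        -- coordinates is an intersection of independent events.
        · have hs : Prod.mk u ⁻¹' E = Set.univ.pi fun _ => {x | B u x = h x} := by
            ext z
            simp [E, hu]
          have hc : {x | B u x = h x} = {x | B u x ≠ h x}ᶜ := by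
            ext x; simp
          rw [hs, Measure.pi_pi, Finset.prod_const, Finset.card_univ, hc,
            prob_compl_eq_one_sub MeasurableSet.of_discrete]
          gcongr
        · have hs : Prod.mk u ⁻¹' E = ∅ := by
            ext z
            simp [E, hu]
          simp [hs]
    _ = _ := by simp

/-- The fibres of `c` are the blocks. The compressed examples meet at most `k` of them, and keeping
those blocks whole leaves a sample between the compressed one and the full one. -/
theorem IsStableCompressionRule.exists_filter_eq {X Y : Type*} {H : Set (X → Y)} {k : ℕ}
    {A : List (X × Y) → X → Y} (hA : IsStableCompressionRule H k A) {m N : ℕ}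
    (c : Fin m → Fin N) (hkN : k ≤ N) (g : Fin m → X × Y) (hg : Realizable H (List.ofFn g)) :
    ∃ J : Finset (Fin N), J.card = k ∧
      A (((List.finRange m).filter (c · ∈ J)).map g) = A (List.ofFn g) := by
  classical
  obtain ⟨K, hK, hlen, hst, -⟩ := hA _ hg
  have hofFn : List.ofFn g = (List.finRange m).map g := List.ofFn_eq_map
  rw [hofFn] at hK hst ⊢
  obtain ⟨l, hl, rfl⟩ := List.sublist_map_iff.mp hK
  have hcard : (l.map c).toFinset.card ≤ k :=
    (List.toFinset_card_le _).trans (by simpa using hlen)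
  -- Pad to exactly `k` blocks, so that the number of blocks left for testing is known.
  obtain ⟨J, hJ, hJk⟩ := Finset.exists_superset_card_eq hcard (by simpa using hkN)
  refine ⟨J, hJk, hst _ (List.Sublist.map _ ?_) (List.Sublist.map _ List.filter_sublist)⟩
  have : l.filter (c · ∈ J) = l := by
    rw [List.filter_eq_self]
    intro i hi
    simpa using hJ (by simpa using ⟨i, hi, rfl⟩)
  rw [← this]
  exact hl.filter _

/-- Cut a sample into `2 * k` blocks of size `b`: the output is determined by some `k` of the blocks,
and consistent with all others. -/
theorem IsStableCompressionRule.measure_pi_error_le {X Y : Type*} [MeasurableSpace X]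
    [DiscreteMeasurableSpace X] [Countable X] {H : Set (X → Y)} {k : ℕ}
    {A : List (X × Y) → X → Y} (hA : IsStableCompressionRule H k A) (D : Measure X)
    [IsProbabilityMeasure D] {h : X → Y} (hh : h ∈ H) (b : ℕ) (ε : ℝ) :
    Measure.pi (fun _ : Fin (2 * k * b) => D)
      {xs | ENNReal.ofReal ε < D {x | A (List.ofFn fun i => (xs i, h (xs i))) x ≠ h x}}
      ≤ 4 ^ k * (1 - ENNReal.ofReal ε) ^ (k * b) := by
  classical
  have : Nonempty X := nonempty_of_isProbabilityMeasure D
  let x₀ : X := Classical.arbitrary X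
  let c : Fin (2 * k * b) → Fin (2 * k) := fun i => (finProdFinEquiv.symm i).1
  -- `B J` sees only the coordinates in the blocks of `J`; the dummy point `x₀` is never used, since
  -- the list is filtered to these blocks.
  let B : (J : Finset (Fin (2 * k))) → ({i // c i ∈ J} → X) → X → Y := fun J u =>
    A (((List.finRange (2 * k * b)).filter (c · ∈ J)).map fun i =>
      if hi : c i ∈ J then (u ⟨i, hi⟩, h (u ⟨i, hi⟩)) else (x₀, h x₀))
  have hB : ∀ J (xs : Fin (2 * k * b) → X), B J (fun i => xs i)
      = A (((List.finRange (2 * k * b)).filter (c · ∈ J)).map fun i => (xs i, h (xs i))) := by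
    intro J xs
    simp only [B]
    congr 1
    apply List.map_congr_left
    intro i hi
    have hi : c i ∈ J := by simpa using hi
    rw [dif_pos hi]
  let E : Finset (Fin (2 * k)) → Set (Fin (2 * k * b) → X) := fun J =>
    {xs | ENNReal.ofReal ε < D {x | B J (fun i => xs i) x ≠ h x} ∧
      ∀ i, ¬ c i ∈ J → B J (fun i => xs i) (xs i) = h (xs i)}
  let P : Finset (Finset (Fin (2 * k))) := Finset.univ.powersetCard k
  have hcover : {xs : Fin (2 * k * b) → X |
      ENNReal.ofReal ε < D {x | A (List.ofFn fun i => (xs i, h (xs i))) x ≠ h x}}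
      ⊆ ⋃ J ∈ P, E J := by
    intro xs hxs
    have hreal : Realizable H (List.ofFn fun i => (xs i, h (xs i))) := by
      refine ⟨h, hh, fun p hp => ?_⟩
      obtain ⟨i, rfl⟩ := (List.mem_ofFn' _ _).mp hp
      rfl
    obtain ⟨J, hJ, hJA⟩ := hA.exists_filter_eq c (by omega) _ hreal
    obtain ⟨-, -, -, -, hcons⟩ := hA _ hreal
    simp only [Set.mem_iUnion]
    refine ⟨J, Finset.mem_powersetCard.mpr ⟨Finset.subset_univ _, hJ⟩, ?_, fun i _ => ?_⟩
    · rw [hB, hJA]; exact hxs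
    · rw [hB, hJA]; exact hcons _ ((List.mem_ofFn' _ _).mpr ⟨i, rfl⟩)
  have hcardP : (P.card : ENNReal) ≤ 4 ^ k := by
    have : P.card ≤ 4 ^ k := by
      rw [Finset.card_powersetCard, Finset.card_univ, Fintype.card_fin]
      calc (2 * k).choose k ≤ 2 ^ (2 * k) := Nat.choose_le_two_pow _ _
        _ = 4 ^ k := by rw [pow_mul]; norm_num
    exact_mod_cast this
  have hcardJ : ∀ J ∈ P, Fintype.card {i // ¬ c i ∈ J} = k * b := by
    intro J hJ
    have hJ := (Finset.mem_powersetCard.mp hJ).2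
    have e : {i // ¬ c i ∈ J} ≃ {j // j ∈ (Jᶜ ×ˢ (Finset.univ : Finset (Fin b)))} :=
      finProdFinEquiv.symm.subtypeEquiv fun i => by simp [c]
    rw [Fintype.card_congr e, Fintype.card_coe, Finset.card_product, Finset.card_compl, hJ,
      Finset.card_univ, Fintype.card_fin, Fintype.card_fin, two_mul, Nat.add_sub_cancel]
  calc _ ≤ Measure.pi (fun _ : Fin (2 * k * b) => D) (⋃ J ∈ P, E J) := measure_mono hcover
    _ ≤ ∑ J ∈ P, Measure.pi (fun _ : Fin (2 * k * b) => D) (E J) :=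
        measure_biUnion_finset_le _ _
    _ ≤ ∑ J ∈ P, (1 - ENNReal.ofReal ε) ^ (k * b) := by
        refine Finset.sum_le_sum fun J hJ => ?_
        rw [← hcardJ J hJ]
        exact measure_pi_consistent_le D h (fun i => c i ∈ J) (B J) ε
    _ = P.card * (1 - ENNReal.ofReal ε) ^ (k * b) := by rw [Finset.sum_const, nsmul_eq_mul]
    _ ≤ _ := by gcongr

/-- A stable compression rule of size zero has a constant output that is always correct. -/
theorem IsStableCompressionRule.eq_of_size_zero {X Y : Type*} {H : Set (X → Y)}
    {A : List (X × Y) → X → Y} (hA : IsStableCompressionRule H 0 A) {h : X → Y} (hh : h ∈ H) :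
    A [] = h := by
  funext x
  obtain ⟨K, -, hK, hst, hcons⟩ := hA [(x, h x)] ⟨h, hh, by simp⟩
  obtain rfl : K = [] := List.length_eq_zero_iff.mp (by omega)
  rw [hst [] (by simp) (by simp)]
  exact hcons (x, h x) (by simp)

/-- The number of examples sufficient for a stable compression rule of size `k`. -/
noncomputable def stableSampleSize (k : ℕ) (ε δ : ℝ) : ℕ :=
  if ε < 1 ∧ δ < 1 then 2 * k * ⌈(2 * k + Real.log (1 / δ)) / (ε * k)⌉₊ else 0

theorem stableSampleSize_le (k : ℕ) {ε δ : ℝ} (hε : 0 < ε) (hδ : 0 < δ) (hδ' : δ ≤ 1) :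
    (stableSampleSize k ε δ : ℝ) ≤ 6 * ((k + Real.log (1 / δ)) / ε) := by
  have hlog : 0 ≤ Real.log (1 / δ) := Real.log_nonneg (by rw [le_div_iff₀ hδ]; linarith)
  rcases k.eq_zero_or_pos with rfl | hk
  · simp only [stableSampleSize, mul_zero, zero_mul, ite_self, Nat.cast_zero]
    positivity
  have hk' : (0 : ℝ) < k := by exact_mod_cast hk
  unfold stableSampleSize
  split_ifs with h
  · have hc := (Nat.ceil_lt_add_one
      (show 0 ≤ (2 * k + Real.log (1 / δ)) / (ε * k) by positivity)).le
    push_cast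
    calc _ ≤ 2 * (k : ℝ) * ((2 * k + Real.log (1 / δ)) / (ε * k) + 1) := by gcongr
      _ = (4 * k + 2 * Real.log (1 / δ) + 2 * k * ε) / ε := by field_simp; ring
      -- Rounding up costs at most one example per block, `2 * k` in all, absorbed because `ε < 1`;
      -- hence `4 + 2 = 6`.
      _ ≤ (6 * (k + Real.log (1 / δ))) / ε := by
        gcongr
        nlinarith [h.1]
      _ = _ := by ring
  · simp only [Nat.cast_zero]
    positivity

/-- From `1 - ε ≤ exp (-ε)` and `4 ≤ exp 2`: the term `2 * k` in the hypothesis pays for the union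
bound. -/
theorem four_pow_mul_one_sub_pow_le {k b : ℕ} {ε δ : ℝ} (hε : ε ≤ 1) (hδ : 0 < δ)
    (hb : 2 * k + Real.log (1 / δ) ≤ ε * k * b) : 4 ^ k * (1 - ε) ^ (k * b) ≤ δ := by
  have h₁ : (1 - ε) ^ (k * b) ≤ Real.exp (-(2 * k + Real.log (1 / δ))) := by
    calc (1 - ε) ^ (k * b) ≤ Real.exp (-ε) ^ (k * b) := by
          have := Real.one_sub_le_exp_neg ε
          have : 0 ≤ 1 - ε := by linarith
          gcongr
      _ = Real.exp (-(ε * k * b)) := by rw [← Real.exp_nat_mul]; push_cast; ring_nf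
      _ ≤ _ := by gcongr
  have h₂ : (4 : ℝ) ^ k ≤ Real.exp (2 * k) := by
    have : (4 : ℝ) ≤ Real.exp 2 := by
      have h := Real.add_one_le_exp (1 : ℝ)
      have : Real.exp 2 = Real.exp 1 * Real.exp 1 := by rw [← Real.exp_add]; norm_num
      nlinarith
    rw [mul_comm, Real.exp_nat_mul]
    gcongr
  calc 4 ^ k * (1 - ε) ^ (k * b)
      ≤ Real.exp (2 * k) * Real.exp (-(2 * k + Real.log (1 / δ))) := by
        have : 0 ≤ (1 - ε) ^ (k * b) := pow_nonneg (by linarith) _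
        gcongr
    _ = Real.exp (Real.log δ) := by
        rw [← Real.exp_add, one_div, Real.log_inv]; ring_nf
    _ = δ := Real.exp_log hδ

theorem IsStableCompressionRule.measure_pi_stableSampleSize_le {X Y : Type*} [MeasurableSpace X]
    [DiscreteMeasurableSpace X] [Countable X] {H : Set (X → Y)} {k : ℕ}
    {A : List (X × Y) → X → Y} (hA : IsStableCompressionRule H k A) (D : Measure X)
    [IsProbabilityMeasure D] {h : X → Y} (hh : h ∈ H) {ε δ : ℝ} (hε : 0 < ε) (hδ : 0 < δ) :
    Measure.pi (fun _ : Fin (stableSampleSize k ε δ) => D)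
      {xs | ENNReal.ofReal ε < D {x | A (List.ofFn fun i => (xs i, h (xs i))) x ≠ h x}}
      ≤ ENNReal.ofReal δ := by
  rcases le_or_gt 1 δ with hδ' | hδ'
  · exact prob_le_one.trans (by simpa using ENNReal.ofReal_le_ofReal hδ')
  rcases le_or_gt 1 ε with hε' | hε'
  · have : ∀ s : Set X, ¬ ENNReal.ofReal ε < D s := fun s =>
      not_lt.mpr (prob_le_one.trans (by simpa using ENNReal.ofReal_le_ofReal hε'))
    simp [this]
  -- For `k = 0` there are no blocks and the sample is empty, but then the output on `[]` is already
  -- the target.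
  rcases k.eq_zero_or_pos with rfl | hk
  · have h0 : stableSampleSize 0 ε δ = 0 := by simp [stableSampleSize]
    have : ∀ xs : Fin (stableSampleSize 0 ε δ) → X,
        (List.ofFn fun i => (xs i, h (xs i))) = [] := fun xs =>
      List.length_eq_zero_iff.mp (by simp [h0])
    simp [this, hA.eq_of_size_zero hh]
  · have hk' : (0 : ℝ) < k := by exact_mod_cast hk
    rw [stableSampleSize, if_pos ⟨hε', hδ'⟩]
    refine (hA.measure_pi_error_le D hh _ ε).trans ?_
    have hb := Nat.le_ceil ((2 * k + Real.log (1 / δ)) / (ε * k))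
    rw [div_le_iff₀ (by positivity), mul_comm _ (ε * (k : ℝ))] at hb
    have := ENNReal.ofReal_le_ofReal (four_pow_mul_one_sub_pow_le hε'.le hδ hb)
    rwa [ENNReal.ofReal_mul (by positivity), ENNReal.ofReal_pow (sub_nonneg.mpr hε'.le),
      ENNReal.ofReal_pow (by norm_num), ENNReal.ofReal_sub _ hε.le, ENNReal.ofReal_one,
      ENNReal.ofReal_ofNat] at this

/-! ### Sample complexity of chain-of-thought learning -/

theorem HasStableCompressionRule.cotLearnableWith {Tok : Type*} [Finite Tok]
    {F : Set (List Tok → Tok)} {k : ℕ} (hF : HasStableCompressionRule F k) {T : ℕ} (hT : 1 ≤ T) :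
    CoTLearnableWith F hT (stableSampleSize k) := by
  obtain ⟨A, hA⟩ := (isSampleReduction_cotClass F T).hasStableCompressionRule hF
  have : DiscreteMeasurableSpace (List Tok) := ⟨fun _ => trivial⟩
  refine ⟨fun S x => A S x ⟨T - 1, by omega⟩, fun ε δ hε hδ D _ f hf => ?_⟩
  refine (measure_mono fun xs hxs => ?_).trans
    (hA.measure_pi_stableSampleSize_le D (Set.mem_image_of_mem _ hf) hε hδ)
  -- A wrong last token forces a wrong chain, so the end-to-end error is at most the error on whole
  -- chains.
  refine lt_of_lt_of_le hxs (measure_mono (Set.ofPred_subset_ofPred.mpr fun x hx heq => hx ?_))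
  simp only [heq, e2e]

theorem CoTLearnableWith.cotSampleComplexity_le {Tok : Type*} {F : Set (List Tok → Tok)} {T : ℕ}
    {hT : 1 ≤ T} {m : ℝ → ℝ → ℕ} (h : CoTLearnableWith F hT m) {ε δ : ℝ} (hε : 0 < ε)
    (hδ : 0 < δ) : cotSampleComplexity F hT ε δ ≤ (m ε δ : ℕ∞) := by
  obtain ⟨Lrn, hL⟩ := h
  exact iInf₂_le (m ε δ) ⟨Lrn, hL ε δ hε hδ⟩

theorem mainTheorem6 :
    ∃ C : ℝ, 0 < C ∧
      ∀ (Tok : Type*) [Finite Tok] [Nonempty Tok] (F : Set (List Tok → Tok)) (k : ℕ),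
        -- stable compression lifts to chains of thought, with the same size, in either form
        (HasStableCompressionScheme F k →
          ∀ T : ℕ, HasStableCompressionScheme (cotClass F T) k) ∧
        (HasStableCompressionRule F k →
          ∀ T : ℕ, HasStableCompressionRule (cotClass F T) k) ∧
        -- the sample complexity bound, with one function `m` for all `T`
        (HasStableCompressionScheme F k ∨ HasStableCompressionRule F k →
          ∃ m : ℝ → ℝ → ℕ,
            (∀ ε δ : ℝ, 0 < ε → 0 < δ → δ ≤ 1 →
              (m ε δ : ℝ) ≤ C * ((k + Real.log (1 / δ)) / ε)) ∧
            ∀ (T : ℕ) (hT : 1 ≤ T),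
              CoTLearnableWith F hT m ∧
              ∀ ε δ : ℝ, 0 < ε → 0 < δ → cotSampleComplexity F hT ε δ ≤ (m ε δ : ℕ∞)) := by
  refine ⟨6, by norm_num, fun Tok _ _ F k => ⟨?_, ?_, fun h => ?_⟩⟩
  · exact fun h T => (isSampleReduction_cotClass F T).hasStableCompressionScheme h
  · exact fun h T => (isSampleReduction_cotClass F T).hasStableCompressionRule h
  · have hR : HasStableCompressionRule F k :=
      h.elim HasStableCompressionScheme.hasStableCompressionRule id
    exact ⟨stableSampleSize k, fun ε δ hε hδ hδ' => stableSampleSize_le k hε hδ hδ',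
      fun T hT => ⟨hR.cotLearnableWith hT, fun ε δ hε hδ =>
        (hR.cotLearnableWith hT).cotSampleComplexity_le hε hδ⟩⟩
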